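/- Throughout, for an integer sequence $A=(a_n)_{n\ge 1}$, a prime $p$ is a *primitive prime divisor* of $a_n$ if $p\mid a_n$ and $p\nmid a_m$ for every $1\le m<n$ with $a_m\neq 0$. The *Zsigmondy bound* $Z(A)$ is the largest $n$ such that $a_n$ has no primitive prime divisor, with $Z(A)=\infty$ if there are infinitely many such $n$, and with the convention $Z(A)=1$ if there is no such $n$. **Theorem 3.2.** Let $d$ be a squarefree positive integer, let $K=\mathbb{Q}(\sqrt d)\subset\mathbb{R}$ with ring of integers $R$, and let $u\in R$ be a unit with $u>1$ and $N_{K/\mathbb{Q}}(u)=-1$. Let $\Delta=(\Delta_n)_{n\ge 1}$ with $\Delta_n=N_{K/\mathbb{Q}}(u^n-1)$, and let $\Delta'=(\Delta'_n)_{n\ge1}$ be the sequence obtained from $\Delta$ by removing the terms $\Delta_n$ with $n\equiv 2 \pmod 4$ and renumbering the remaining terms consecutively (so $\Delta'_1=\Delta_1$, $\Delta'_2=\Delta_3$, $\Delta'_3=\Delta_4$, $\Delta'_4=\Delta_5$, $\Delta'_5=\Delta_7$, and so on). If $u>13$, then $Z(\Delta')\le 4$. If $u\le 13$, then exactly one of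 the following holds: - $u=1+\sqrt2$, $Z(\Delta')=3$, and the only term of $\Delta'$ without a primitive prime divisor is $\Delta'_3$; - $u=\frac{1+\sqrt5}{2}$, $Z(\Delta')=18$, and the only terms of $\Delta'$ without a primitive prime divisor are $\Delta'_9,\Delta'_{15},\Delta'_{18}$ and the trivial first term $\Delta'_1=-1$; - $u$ is neither of these two numbers, every term of $\Delta'$ has a primitive prime divisor, and $Z(\Delta')=1$. -/

import Mathlib

open scoped NumberField

noncomputable section

/-- A prime `p` is a primitive prime divisor of the `n`th term of the integer sequence
`A 1, A 2, A 3, …` (the value `A 0` is never used): `p` divides `A n` and divides no earlier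
nonzero term. -/
def IsPrimitivePrimeDivisor (A : ℕ → ℤ) (n p : ℕ) : Prop :=
  p.Prime ∧ (p : ℤ) ∣ A n ∧ ∀ m : ℕ, 1 ≤ m → m < n → A m ≠ 0 → ¬ (p : ℤ) ∣ A m

/-- The set of indices `n ≥ 1` for which the `n`th term of `A` has no primitive prime divisor. -/
def failureSet (A : ℕ → ℤ) : Set ℕ :=
  {n : ℕ | 1 ≤ n ∧ ¬ ∃ p : ℕ, IsPrimitivePrimeDivisor A n p}

open Classical in
/-- The Zsigmondy bound of `A`: the maximum of the set of indices of terms without a primitive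
prime divisor, and `∞` if that set is infinite. If every term has a primitive prime divisor, the
bound is `1` by convention. -/
def zsigmondyBound (A : ℕ → ℤ) : ℕ∞ :=
  if (failureSet A).Infinite then ⊤
  else if failureSet A = ∅ then 1
  else ((sSup (failureSet A) : ℕ) : ℕ∞)

/-- The field `ℚ(√d)`, as a subfield of `ℝ`. -/
abbrev QSqrt (d : ℕ) : IntermediateField ℚ ℝ :=
  IntermediateField.adjoin ℚ {√(d : ℝ)}

/-- `ℚ(√d)` is a number field; hence its ring of integers is a finite free `ℤ`-module and the
norm `Algebra.norm ℤ` on it is the usual field norm. -/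
instance instNumberFieldQSqrt (d : ℕ) : NumberField (QSqrt d) where
  to_charZero := inferInstance
  to_finiteDimensional := by
    apply IntermediateField.adjoin.finiteDimensional
    refine IsIntegral.of_pow (n := 2) (by norm_num) ?_
    rw [Real.sq_sqrt (Nat.cast_nonneg d)]
    simpa using (isIntegral_algebraMap (R := ℚ) (A := ℝ) (x := (d : ℚ)))

/-- The Lehmer-Pierce sequence `Δ_n = N_{K/ℚ}(α ^ n - 1)` associated to `α`. -/
def lehmerPierce {K : Type*} [Field K] (α : 𝓞 K) (n : ℕ) : ℤ :=
  Algebra.norm ℤ (α ^ n - 1)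

/-- The sequence obtained from `A 1, A 2, A 3, …` by removing the terms `A k` with
`k ≡ 2 (mod 4)` and renumbering the remaining terms `1, 2, 3, …`
(`Nat.nth P` enumerates the naturals satisfying `P` in increasing order, starting from `0`). -/
def removeTwoModFour (A : ℕ → ℤ) (n : ℕ) : ℤ :=
  A (Nat.nth (fun k => 1 ≤ k ∧ k % 4 ≠ 2) (n - 1))

end

/-!
Let `N u = -1` and `v = u²`, so that `N v = 1` and `v` has trace `s = a² + 2` with `a = tr u`. Then
`Δ_{2m} = N(vᵐ - 1)`, and `Δ_{2m} = -Δ_m²` for odd `m`, so up to the order of its terms `Δ'` has the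
same prime divisors as the sequence `N(vᵐ - 1)`, which is a product of cyclotomic values
`N(Φ_d(v))` over `d ∣ m`. A prime `p` that divides `N(Φ_m(v))` but not `m` is primitive: it forces
`v` to have order exactly `m` modulo a prime above `p`.

If there is no such `p`, then Frobenius shows that for `m ∉ {2, 6, 12}` the value `N(Φ_m(v))` is, up
to sign, a power of a single prime `p ∣ m`. The exponent is at most `2`, because `s` has the form
`a² + 2`. On the other hand each factor `(v - ζ)(v⁻¹ - ζ)` of `N(Φ_m(v))` has absolute value greater
than `s - 2 = a²`, hence `|N(Φ_m(v))| > a ^ (2 φ(m))`, which is a contradiction for `a ≥ 2`. For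
`a = 1` this bound is trivial, and the growth of `tr vᵖ` replaces it: `Φ_n(vᵖ)` is `Φ_{np}(v)` or
`Φ_{np}(v) Φ_n(v)`, according to whether `p` divides `n`.
-/

open Polynomial QuadraticAlgebra

/-- The product `f(v) f(w)`, where `v` and `w = v⁻¹` are the roots of `X² - s X + 1`. It is the norm
of `f(v)`, and is encoded as such in the quadratic ring `ℤ[v]`. -/
noncomputable def normEval (s : ℤ) : ℤ[X] →* ℤ :=
  QuadraticAlgebra.norm.comp (aeval (ω : QuadraticAlgebra ℤ (-1) s)).toMonoidHom

/-- The sum `vⁿ + wⁿ`, where `v` and `w = v⁻¹` are the roots of `X² - s X + 1`. -/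
noncomputable def powTrace (s : ℤ) (n : ℕ) : ℤ :=
  (dickson 1 1 n).eval s

theorem powTrace_zero (s : ℤ) : powTrace s 0 = 2 := by
  norm_num [powTrace]

theorem powTrace_one (s : ℤ) : powTrace s 1 = s := by
  simp [powTrace]

theorem powTrace_add_two (s : ℤ) (n : ℕ) :
    powTrace s (n + 2) = s * powTrace s (n + 1) - powTrace s n := by
  simp [powTrace, dickson_add_two]

theorem powTrace_powTrace (s : ℤ) (m n : ℕ) :
    powTrace (powTrace s n) m = powTrace s (m * n) := by
  simp only [powTrace, dickson_one_one_mul, eval_comp]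

theorem powTrace_two_mul (s : ℤ) (n : ℕ) : powTrace s (2 * n) = powTrace s n ^ 2 - 2 := by
  rw [← powTrace_powTrace, powTrace_add_two, zero_add, powTrace_one, powTrace_zero, sq]

theorem powTrace_prime_modEq (s : ℤ) {p : ℕ} (hp : p.Prime) : powTrace s p ≡ s [ZMOD p] := by
  have : Fact p.Prime := ⟨hp⟩
  have h : dickson 1 (1 : ZMod p) p = (dickson 1 (1 : ℤ) p).map (Int.castRingHom (ZMod p)) := by
    simp [map_dickson]
  rw [← ZMod.intCast_eq_intCast_iff, powTrace, ← eq_intCast (Int.castRingHom (ZMod p)),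
    ← eval_map_apply, ← h, dickson_one_one_zmod_p]
  simp

section Roots

variable {R : Type*} [CommRing R] {s : ℤ} {v w : R}

theorem pow_add_pow_eq_powTrace (hs : v + w = s) (hp : v * w = 1) (n : ℕ) :
    v ^ n + w ^ n = powTrace s n := by
  rw [← dickson_one_one_eval_add_inv v w hp, hs, powTrace, ← eq_intCast (Int.castRingHom R) s,
    ← eq_intCast (Int.castRingHom R) (eval _ _), ← eval_map_apply, map_dickson, map_one]

theorem aeval_mul_aeval_eq_normEval (hs : v + w = s) (hp : v * w = 1) (f : ℤ[X]) :
    aeval v f * aeval w f = normEval s f := by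
  have hv : v * v = (-1 : ℤ) • (1 : R) + s • v := by
    rw [zsmul_eq_mul, zsmul_eq_mul, ← hs]
    push_cast
    linear_combination -hp
  let φ : QuadraticAlgebra ℤ (-1) s →ₐ[ℤ] R := QuadraticAlgebra.lift ⟨v, hv⟩
  have hω : φ ω = v := by simp [φ, QuadraticAlgebra.lift]
  have hstar : φ (star ω) = w := by
    rw [star_eq, trace_omega, map_sub, hω, AlgHom.commutes, eq_intCast, ← hs, add_sub_cancel_left]
  have hf : star (aeval (ω : QuadraticAlgebra ℤ (-1) s) f) = aeval (star ω) f := by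
    have h := hom_eval₂ f (algebraMap ℤ (QuadraticAlgebra ℤ (-1) s)) (starRingEnd _) ω
    rwa [RingHom.ext_int ((starRingEnd _).comp _) (algebraMap ℤ _)] at h
  calc aeval v f * aeval w f = φ (aeval ω f * star (aeval ω f)) := by
        rw [hf, map_mul, ← aeval_algHom_apply, ← aeval_algHom_apply, hω, hstar]
    _ = normEval s f := by
        rw [← algebraMap_norm_eq_mul_star, AlgHom.commutes, eq_intCast]
        rfl

end Roots

theorem exists_add_eq_mul_eq_one_injective (s : ℤ) :
    ∃ (R : Type) (_ : CommRing R) (v w : R),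
      v + w = s ∧ v * w = 1 ∧ Function.Injective (Int.cast : ℤ → R) :=
  ⟨QuadraticAlgebra ℤ (-1) s, inferInstance, ω, star ω, by ext <;> simp, by ext <;> simp,
    algebraMap_injective⟩

theorem normEval_expand (s : ℤ) (k : ℕ) (f : ℤ[X]) :
    normEval s (expand ℤ k f) = normEval (powTrace s k) f := by
  obtain ⟨R, _, v, w, hs, hp, hinj⟩ := exists_add_eq_mul_eq_one_injective s
  apply hinj
  have hp' : v ^ k * w ^ k = 1 := by rw [← mul_pow, hp, one_pow]
  rw [← aeval_mul_aeval_eq_normEval hs hp, expand_aeval, expand_aeval,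
    aeval_mul_aeval_eq_normEval (pow_add_pow_eq_powTrace hs hp k) hp']

theorem normEval_X_sub_C (s c : ℤ) : normEval s (X - C c) = c ^ 2 - s * c + 1 := by
  obtain ⟨R, _, v, w, hs, hp, hinj⟩ := exists_add_eq_mul_eq_one_injective s
  apply hinj
  rw [← aeval_mul_aeval_eq_normEval hs hp]
  simp only [map_sub, aeval_X, aeval_C, algebraMap_int_eq, Int.coe_castRingHom]
  push_cast
  linear_combination hp - c * hs

theorem normEval_X_sub_one (s : ℤ) : normEval s (X - 1) = 2 - s := by
  rw [← C_1, normEval_X_sub_C]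
  ring

theorem normEval_X_add_one (s : ℤ) : normEval s (X + 1) = s + 2 := by
  rw [← sub_neg_eq_add, ← C_1, ← Polynomial.C_neg, normEval_X_sub_C]
  ring

theorem normEval_X_pow_sub_one (s : ℤ) (m : ℕ) :
    normEval s (X ^ m - 1) = 2 - powTrace s m := by
  rw [← normEval_X_sub_one, ← normEval_expand, map_sub (expand ℤ m), expand_X, map_one]

theorem exists_add_eq_mul_eq_one_of_isAlgClosed (F : Type*) [Field F] [IsAlgClosed F] (s : ℤ) :
    ∃ v w : F, v + w = s ∧ v * w = 1 := by
  obtain ⟨v, hv⟩ := IsAlgClosed.exists_root (C 1 * X ^ 2 + C (-s : F) * X + C 1)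
    (by rw [degree_quadratic one_ne_zero]; decide)
  refine ⟨v, s - v, by ring, ?_⟩
  simp only [IsRoot.def, eval_add, eval_mul, eval_C, eval_pow, eval_X] at hv
  linear_combination -hv

section Size

variable {s : ℤ} {n p : ℕ}

theorem abs_normEval_cyclotomic_eq_prod (hs : 2 ≤ s) (hn : 0 < n) :
    (|normEval s (cyclotomic n ℤ)| : ℝ) = ∏ μ ∈ primitiveRoots n ℂ, (s - 2 * μ.re : ℝ) := by
  obtain ⟨v, w, hvw, hp⟩ := exists_add_eq_mul_eq_one_of_isAlgClosed ℂ s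
  have hnorm {μ : ℂ} (hμ : μ ∈ primitiveRoots n ℂ) : ‖μ‖ = 1 :=
    (isPrimitiveRoot_of_mem_primitiveRoots hμ).norm'_eq_one hn.ne'
  have hfactor {μ : ℂ} (hμ : μ ∈ primitiveRoots n ℂ) :
      ‖(v - μ) * (w - μ)‖ = (s - 2 * μ.re : ℝ) := by
    have hre : μ.re ≤ 1 := hnorm hμ ▸ Complex.re_le_norm μ
    have hs' : (2 : ℝ) ≤ s := by exact_mod_cast hs
    have hconj : μ * (starRingEnd ℂ) μ = 1 := by
      rw [Complex.mul_conj, Complex.normSq_eq_norm_sq, hnorm hμ]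
      norm_num
    have htrace : μ + (starRingEnd ℂ) μ = (2 * μ.re : ℝ) := Complex.add_conj μ
    have : (v - μ) * (w - μ) = μ * ((2 * μ.re - s : ℝ) : ℂ) := by
      rw [Complex.ofReal_sub, ← htrace, Complex.ofReal_intCast, ← hvw]
      linear_combination hp - hconj
    rw [this, norm_mul, hnorm hμ, one_mul, Complex.norm_real, Real.norm_eq_abs, abs_sub_comm,
      abs_of_nonneg (by linarith)]
  have heval (z : ℂ) : aeval z (cyclotomic n ℤ) = ∏ μ ∈ primitiveRoots n ℂ, (z - μ) := by
    rw [aeval_def, eval₂_eq_eval_map, map_cyclotomic, cyclotomic_eq_prod_X_sub_primitiveRoots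
      (Complex.isPrimitiveRoot_exp n hn.ne'), eval_prod]
    simp
  rw [← Finset.prod_congr rfl fun μ hμ => hfactor hμ, ← norm_prod, Finset.prod_mul_distrib,
    ← heval, ← heval, aeval_mul_aeval_eq_normEval hvw hp, Complex.norm_intCast]

theorem sub_two_pow_totient_lt (hs : 2 < s) (hn : 2 ≤ n) :
    (s - 2) ^ n.totient < |normEval s (cyclotomic n ℤ)| := by
  have hn' : 0 < n := by lia
  have hs' : (2 : ℝ) < s := by exact_mod_cast hs
  have hre {μ : ℂ} (hμ : μ ∈ primitiveRoots n ℂ) : μ.re < 1 := by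
    have hroot := isPrimitiveRoot_of_mem_primitiveRoots hμ
    have hnorm := hroot.norm'_eq_one hn'.ne'
    refine (hnorm ▸ Complex.re_le_norm μ).lt_of_ne fun h => hroot.ne_one hn ?_
    exact Complex.ext h (Complex.abs_re_eq_norm.mp (by rw [h, hnorm, abs_one]))
  rw [← Int.cast_lt (R := ℝ), Int.cast_abs, abs_normEval_cyclotomic_eq_prod hs.le hn',
    Int.cast_pow, Int.cast_sub, Int.cast_ofNat, ← Complex.card_primitiveRoots,
    ← Finset.prod_const]
  refine Finset.prod_lt_prod_of_nonempty (fun μ _ => by linarith)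
    (fun μ hμ => by linarith [hre hμ]) ?_
  exact ⟨_, (mem_primitiveRoots hn').mpr (Complex.isPrimitiveRoot_exp n hn'.ne')⟩

theorem sub_two_pow_totient_le (hs : 2 < s) (hn : 0 < n) :
    (s - 2) ^ n.totient ≤ |normEval s (cyclotomic n ℤ)| := by
  obtain rfl | hn : n = 1 ∨ 2 ≤ n := by lia
  · rw [cyclotomic_one, normEval_X_sub_one, Nat.totient_one, pow_one, abs_sub_comm]
    exact le_abs_self _
  · exact (sub_two_pow_totient_lt hs hn).le

theorem abs_normEval_cyclotomic_le (hs : 2 ≤ s) (hn : 0 < n) :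
    |normEval s (cyclotomic n ℤ)| ≤ (s + 2) ^ n.totient := by
  have hs' : (2 : ℝ) ≤ s := by exact_mod_cast hs
  have hre {μ : ℂ} (hμ : μ ∈ primitiveRoots n ℂ) : |μ.re| ≤ 1 :=
    (isPrimitiveRoot_of_mem_primitiveRoots hμ).norm'_eq_one hn.ne' ▸ Complex.abs_re_le_norm μ
  rw [← Int.cast_le (R := ℝ), Int.cast_abs, abs_normEval_cyclotomic_eq_prod hs hn,
    Int.cast_pow, Int.cast_add, Int.cast_ofNat, ← Complex.card_primitiveRoots,
    ← Finset.prod_const]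
  exact Finset.prod_le_prod (fun μ hμ => by linarith [abs_le.mp (hre hμ)])
    fun μ hμ => by linarith [abs_le.mp (hre hμ)]

theorem powTrace_sub_two_pow_totient_le_of_dvd (hp : p.Prime) (hn : 0 < n) (hpn : p ∣ n)
    (hs : 2 < powTrace s p) :
    (powTrace s p - 2) ^ n.totient ≤ |normEval s (cyclotomic (n * p) ℤ)| := by
  rw [← cyclotomic_expand_eq_cyclotomic hp hpn, normEval_expand]
  exact sub_two_pow_totient_le hs hn

theorem powTrace_sub_two_pow_totient_le_of_not_dvd (hp : p.Prime) (hn : 0 < n) (hpn : ¬p ∣ n)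
    (hs : 2 < powTrace s p) :
    (powTrace s p - 2) ^ n.totient ≤
      |normEval s (cyclotomic (n * p) ℤ)| * |normEval s (cyclotomic n ℤ)| := by
  rw [← abs_mul, ← map_mul, ← cyclotomic_expand_eq_cyclotomic_mul hp hpn, normEval_expand]
  exact sub_two_pow_totient_le hs hn

end Size

section Prime

variable {s : ℤ} {m n p : ℕ}

theorem exists_isPrimitiveRoot_of_dvd_normEval_cyclotomic [Fact p.Prime] {i : ℕ} (hpm : ¬p ∣ m)
    (h : (p : ℤ) ∣ normEval s (cyclotomic (p ^ i * m) ℤ)) :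
    ∃ v w : AlgebraicClosure (ZMod p), v + w = s ∧ v * w = 1 ∧ IsPrimitiveRoot v m := by
  set F := AlgebraicClosure (ZMod p)
  have : NeZero (m : F) := ⟨fun h0 => hpm ((CharP.cast_eq_zero_iff F p m).1 h0)⟩
  have hroot {v : F} (hv : aeval v (cyclotomic (p ^ i * m) ℤ) = 0) : IsPrimitiveRoot v m := by
    rwa [← isRoot_cyclotomic_prime_pow_mul_iff_of_charP (p := p) (k := i), IsRoot.def,
      ← map_cyclotomic _ (algebraMap ℤ F), eval_map_algebraMap]
  obtain ⟨v, w, hs, hp⟩ := exists_add_eq_mul_eq_one_of_isAlgClosed F s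
  have h0 := aeval_mul_aeval_eq_normEval hs hp (cyclotomic (p ^ i * m) ℤ)
  rw [(CharP.intCast_eq_zero_iff F p _).2 h, mul_eq_zero] at h0
  rcases h0 with hv | hw
  · exact ⟨v, w, hs, hp, hroot hv⟩
  · exact ⟨w, v, by rw [add_comm, hs], by rw [mul_comm, hp], hroot hw⟩

theorem dvd_sub_one_or_dvd_add_one (hp : p.Prime) {i : ℕ} (hpm : ¬p ∣ m)
    (h : (p : ℤ) ∣ normEval s (cyclotomic (p ^ i * m) ℤ)) : m ∣ p - 1 ∨ m ∣ p + 1 := by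
  have : Fact p.Prime := ⟨hp⟩
  obtain ⟨v, w, hs, hvw, hv⟩ := exists_isPrimitiveRoot_of_dvd_normEval_cyclotomic hpm h
  have hfrob : v ^ p + w ^ p = v + w := by
    rw [← add_pow_char, hs, ← frobenius_def, map_intCast]
  have hvwp : v ^ p * w ^ p = 1 := by rw [← mul_pow, hvw, one_pow]
  have hroots : (v ^ p - v) * (v ^ p - w) = 0 := by
    linear_combination v ^ p * hfrob - hvwp + hvw
  rcases mul_eq_zero.1 hroots with hvp | hvp
  · left
    apply hv.dvd_of_pow_eq_one
    apply mul_right_cancel₀ (left_ne_zero_of_mul_eq_one hvw)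
    rw [← pow_succ, Nat.sub_add_cancel hp.one_le, sub_eq_zero.1 hvp, one_mul]
  · right
    apply hv.dvd_of_pow_eq_one
    rw [pow_succ, sub_eq_zero.1 hvp, mul_comm, hvw]

theorem dvd_normEval_X_pow_sub_one_iff (hp : p.Prime) (hpm : ¬p ∣ m)
    (h : (p : ℤ) ∣ normEval s (cyclotomic m ℤ)) (j : ℕ) :
    (p : ℤ) ∣ normEval s (X ^ j - 1) ↔ m ∣ j := by
  have : Fact p.Prime := ⟨hp⟩
  obtain ⟨v, w, hs, hvw, hv⟩ :=
    exists_isPrimitiveRoot_of_dvd_normEval_cyclotomic (i := 0) hpm (by simpa using h)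
  have hw : IsPrimitiveRoot w m := by
    rw [eq_inv_of_mul_eq_one_right hvw]
    exact hv.inv
  rw [← CharP.intCast_eq_zero_iff (AlgebraicClosure (ZMod p)) p,
    ← aeval_mul_aeval_eq_normEval hs hvw, mul_eq_zero]
  simp only [map_sub, aeval_X_pow, map_one, sub_eq_zero, hv.pow_eq_one_iff_dvd,
    hw.pow_eq_one_iff_dvd, or_self]

theorem prime_dvd_powTrace_sub_two (hp : p.Prime)
    (h : (p : ℤ) ∣ normEval s (cyclotomic (n * p) ℤ)) : (p : ℤ) ∣ powTrace s n - 2 := by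
  have hdvd : (p : ℤ) ∣ 2 - powTrace s (p * n) := by
    rw [← normEval_X_pow_sub_one, mul_comm p]
    exact h.trans (map_dvd _ (cyclotomic.dvd_X_pow_sub_one _ _))
  rw [← powTrace_powTrace] at hdvd
  simpa using dvd_sub (powTrace_prime_modEq (powTrace s n) hp).dvd hdvd

theorem cyclotomic_mul_dvd_expand (hm : m ≠ 0) (hn : 0 < n) :
    cyclotomic (m * n) ℤ ∣ expand ℤ m (cyclotomic n ℤ) := by
  have hζ := Complex.isPrimitiveRoot_exp (m * n) (by positivity)
  rw [cyclotomic_eq_minpoly hζ (by positivity)]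
  refine minpoly.isIntegrallyClosed_dvd (hζ.isIntegral (by positivity)) ?_
  have hζm := hζ.pow (by positivity) rfl
  rw [expand_aeval, ← eval_map_algebraMap, map_cyclotomic]
  exact hζm.isRoot_cyclotomic hn

theorem normEval_cyclotomic_mul_dvd (s : ℤ) (hm : m ≠ 0) (hn : 0 < n) :
    normEval s (cyclotomic (m * n) ℤ) ∣ normEval (powTrace s m) (cyclotomic n ℤ) := by
  rw [← normEval_expand]
  exact map_dvd _ (cyclotomic_mul_dvd_expand hm hn)

end Prime

section CubeFree

variable {t : ℤ} {p : ℕ}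

theorem aeval_geom_sum_odd {R : Type*} [CommRing R] {v w : R} (hs : v + w = t)
    (hvw : v * w = 1) (h : ℕ) :
    aeval v (∑ i ∈ Finset.range (2 * h + 1), X ^ i : ℤ[X]) =
      v ^ h * (1 + ∑ j ∈ Finset.range h, powTrace t (j + 1) : ℤ) := by
  simp only [map_sum, aeval_X_pow]
  induction h with
  | zero => simp
  | succ h ih =>
    have hw : v ^ (h + 1) * w ^ (h + 1) = 1 := by rw [← mul_pow, hvw, one_pow]
    rw [Finset.sum_range_succ _ h, ← add_assoc, Int.cast_add, ← pow_add_pow_eq_powTrace hs hvw,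
      show 2 * (h + 1) + 1 = 2 * h + 1 + 1 + 1 by ring, Finset.sum_range_succ, geom_sum_succ, ih]
    linear_combination -hw

theorem normEval_geom_sum_odd (t : ℤ) (h : ℕ) :
    normEval t (∑ i ∈ Finset.range (2 * h + 1), X ^ i) =
      (1 + ∑ j ∈ Finset.range h, powTrace t (j + 1)) ^ 2 := by
  obtain ⟨R, _, v, w, hs, hvw, hinj⟩ := exists_add_eq_mul_eq_one_injective t
  apply hinj
  have hvwh : v ^ h * w ^ h = 1 := by rw [← mul_pow, hvw, one_pow]
  rw [← aeval_mul_aeval_eq_normEval hs hvw, aeval_geom_sum_odd hs hvw,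
    aeval_geom_sum_odd (add_comm v w ▸ hs) (mul_comm v w ▸ hvw), Int.cast_pow]
  linear_combination hvwh * (1 + ∑ j ∈ Finset.range h, powTrace t (j + 1) : ℤ) ^ 2

theorem powTrace_modEq (t : ℤ) (j : ℕ) :
    powTrace t j ≡ 2 + j ^ 2 * (t - 2) [ZMOD (t - 2) ^ 2] := by
  rw [Int.modEq_comm, Int.modEq_iff_dvd]
  induction j using Nat.twoStepInduction with
  | zero => simp [powTrace_zero]
  | one => simp [powTrace_one]
  | more j ih₀ ih₁ =>
    obtain ⟨x, hx⟩ := ih₀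
    obtain ⟨y, hy⟩ := ih₁
    refine ⟨t * y - x + (j + 1) ^ 2, ?_⟩
    rw [powTrace_add_two]
    push_cast at hy ⊢
    linear_combination t * hy - hx

theorem six_mul_sum_range_succ_sq (h : ℕ) :
    6 * ∑ j ∈ Finset.range h, ((j + 1 : ℕ) : ℤ) ^ 2 = h * (h + 1) * (2 * h + 1) := by
  induction h with
  | zero => simp
  | succ h ih =>
    rw [Finset.sum_range_succ, mul_add, ih]
    push_cast
    ring

theorem one_add_sum_powTrace_modEq (hp : p.Prime) {h : ℕ} (hph : p = 2 * h + 1)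
    (hpt : (p : ℤ) ∣ t - 2) (h9 : p = 3 → (9 : ℤ) ∣ t - 2) :
    1 + ∑ j ∈ Finset.range h, powTrace t (j + 1) ≡ p [ZMOD p ^ 2] := by
  have hsq : (p : ℤ) ^ 2 ∣ (∑ j ∈ Finset.range h, ((j + 1 : ℕ) : ℤ) ^ 2) * (t - 2) := by
    by_cases hp3 : p = 3
    · exact dvd_mul_of_dvd_right (by simpa [hp3] using h9 hp3) _
    · rw [sq]
      refine mul_dvd_mul ?_ hpt
      have hp6 : ¬p ∣ 6 := fun h6 => by
        have := Nat.le_of_dvd (by norm_num) h6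
        have := hp.two_le
        interval_cases p <;> lia
      have hcop : IsCoprime (p : ℤ) (6 : ℕ) :=
        Nat.isCoprime_iff_coprime.mpr ((Nat.Prime.coprime_iff_not_dvd hp).mpr hp6)
      refine hcop.dvd_of_dvd_mul_left (Dvd.intro_left (h * (h + 1) : ℤ) ?_)
      rw [Nat.cast_ofNat, six_mul_sum_range_succ_sq, hph]
      push_cast
      rfl
  calc 1 + ∑ j ∈ Finset.range h, powTrace t (j + 1)
      ≡ 1 + ∑ j ∈ Finset.range h, (2 + ((j + 1 : ℕ) : ℤ) ^ 2 * (t - 2)) [ZMOD p ^ 2] := by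
        exact (Int.ModEq.refl 1).add
          (Int.ModEq.sum fun j _ => (powTrace_modEq t (j + 1)).of_dvd (pow_dvd_pow_of_dvd hpt 2))
    _ = p + (∑ j ∈ Finset.range h, ((j + 1 : ℕ) : ℤ) ^ 2) * (t - 2) := by
        rw [Finset.sum_add_distrib, ← Finset.sum_mul, Finset.sum_const, Finset.card_range, hph,
          nsmul_eq_mul]
        push_cast
        ring
    _ ≡ p [ZMOD p ^ 2] := by
        simpa using (Int.ModEq.refl (p : ℤ)).add (Int.modEq_zero_iff_dvd.mpr hsq)

theorem not_prime_cube_dvd_normEval_cyclotomic_prime (hp : p.Prime) (hp2 : p ≠ 2)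
    (hpt : (p : ℤ) ∣ t - 2) (h9 : p = 3 → (9 : ℤ) ∣ t - 2) :
    ¬(p : ℤ) ^ 3 ∣ normEval t (cyclotomic p ℤ) := by
  have : Fact p.Prime := ⟨hp⟩
  obtain ⟨h, hph⟩ := hp.odd_of_ne_two hp2
  obtain ⟨k, hk⟩ := (one_add_sum_powTrace_modEq hp hph hpt h9).symm.dvd
  rw [cyclotomic_prime, hph, normEval_geom_sum_odd, eq_add_of_sub_eq hk, ← hph]
  intro hdvd
  have hpZ : Prime (p : ℤ) := Nat.prime_iff_prime_int.mp hp
  rw [show ((p : ℤ) ^ 2 * k + p) ^ 2 = p ^ 2 * (p * k + 1) ^ 2 by ring, pow_succ,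
    mul_dvd_mul_iff_left (pow_ne_zero 2 hpZ.ne_zero)] at hdvd
  exact hpZ.not_dvd_one ((dvd_add_right (dvd_mul_right _ k)).mp (hpZ.dvd_of_dvd_pow hdvd))

end CubeFree

section SqAddTwo

variable {a : ℤ} {m n p : ℕ}

theorem exists_sq_eq_powTrace_add (a : ℤ) (n : ℕ) :
    ∃ x y : ℤ, x ^ 2 = powTrace (a ^ 2 + 2) n + 2 * (-1) ^ n ∧
      x ^ 2 - 4 * (-1) ^ n = (a ^ 2 + 4) * y ^ 2 := by
  let α : QuadraticAlgebra ℤ 1 a := ω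
  have hα : α + star α = (a : ℤ) := by ext <;> simp [α]
  have hα' : α * star α = -1 := by ext <;> simp [α]
  have hs : α ^ 2 + star α ^ 2 = (a ^ 2 + 2 : ℤ) := by
    push_cast
    linear_combination (α + star α + a) * hα - 2 * hα'
  have hp : α ^ 2 * star α ^ 2 = 1 := by rw [← mul_pow, hα', neg_one_sq]
  have hnorm : (α ^ n).norm = (-1) ^ n := by
    rw [map_pow]
    simp [α, norm_def]
  refine ⟨trace (α ^ n), (α ^ n).im, ?_, ?_⟩
  · apply algebraMap_injective (a := 1) (b := a)
    rw [map_pow, algebraMap_trace_eq_add_star, star_pow, map_add, eq_intCast, eq_intCast,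
      ← pow_add_pow_eq_powTrace hs hp]
    push_cast
    rw [← hα']
    ring
  · rw [← hnorm, norm_def, trace_def]
    ring

theorem nine_dvd_powTrace_sub_two (h : (3 : ℤ) ∣ powTrace (a ^ 2 + 2) n - 2) :
    (9 : ℤ) ∣ powTrace (a ^ 2 + 2) n - 2 := by
  obtain ⟨x, y, hx, hy⟩ := exists_sq_eq_powTrace_add a n
  have sq_dvd {z : ℤ} (hz : 3 ∣ z ^ 2) : 9 ∣ z ^ 2 :=
    pow_dvd_pow_of_dvd (Int.prime_three.dvd_of_dvd_pow hz) 2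
  rcases Nat.even_or_odd n with hn | hn
  · have : powTrace (a ^ 2 + 2) n - 2 = (a ^ 2 + 4) * y ^ 2 := by
      rw [hn.neg_one_pow] at hx hy
      linear_combination hy - hx
    have h3 : ¬(3 : ℤ) ∣ a ^ 2 + 4 := by
      rw [← Nat.cast_ofNat, ← ZMod.intCast_zmod_eq_zero_iff_dvd]
      push_cast
      generalize (a : ZMod 3) = b
      decide +revert
    rw [this] at h ⊢
    exact dvd_mul_of_dvd_right (sq_dvd ((Int.prime_three.dvd_or_dvd h).resolve_left h3)) _
  · have : powTrace (a ^ 2 + 2) n - 2 = x ^ 2 := by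
      rw [hn.neg_one_pow] at hx
      linear_combination -hx
    rw [this] at h ⊢
    exact sq_dvd h

theorem not_eight_dvd_normEval_cyclotomic (hm : 0 < m) :
    ¬8 ∣ normEval (a ^ 2 + 2) (cyclotomic (4 * m) ℤ) := by
  intro h8
  have hsq : (8 : ℤ) ∣ powTrace (a ^ 2 + 2) m ^ 2 := by
    have := normEval_cyclotomic_mul_dvd (a ^ 2 + 2) (m := 2 * m) (n := 2) (by lia) two_pos
    rw [cyclotomic_two, normEval_X_add_one, powTrace_two_mul, sub_add_cancel,
      show 2 * m * 2 = 4 * m by ring] at this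
    exact h8.trans this
  obtain ⟨x, -, hx, -⟩ := exists_sq_eq_powTrace_add a m
  have hmod8 : ∀ z : ZMod 8, (z ^ 2 - 2) ^ 2 ≠ 0 ∧ (z ^ 2 + 2) ^ 2 ≠ 0 := by decide
  rw [eq_sub_of_add_eq hx.symm, ← Nat.cast_ofNat, ← ZMod.intCast_zmod_eq_zero_iff_dvd] at hsq
  push_cast at hsq
  rcases Nat.even_or_odd m with hm | hm <;> rw [hm.neg_one_pow] at hsq
  · exact (hmod8 x).1 (by linear_combination hsq)
  · exact (hmod8 x).2 (by linear_combination hsq)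

theorem not_prime_cube_dvd_normEval_cyclotomic_mul (hp : p.Prime) (hp2 : p ≠ 2) (hn : n ≠ 0) :
    ¬(p : ℤ) ^ 3 ∣ normEval (a ^ 2 + 2) (cyclotomic (n * p) ℤ) := by
  intro h
  have hpn : (p : ℤ) ∣ powTrace (a ^ 2 + 2) n - 2 :=
    prime_dvd_powTrace_sub_two hp ((dvd_pow_self _ three_ne_zero).trans h)
  refine not_prime_cube_dvd_normEval_cyclotomic_prime hp hp2 hpn ?_
    (h.trans (normEval_cyclotomic_mul_dvd _ hn hp.pos))
  rintro rfl
  exact nine_dvd_powTrace_sub_two hpn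

end SqAddTwo

section ExistsPrime

variable {a : ℤ}

theorem normEval_X_sq_sub (s c : ℤ) : normEval s (X ^ 2 - C c * X + 1) = (s - c) ^ 2 := by
  obtain ⟨R, _, v, w, hs, hp, hinj⟩ := exists_add_eq_mul_eq_one_injective s
  have haeval {x y : R} (hxy : x + y = s) (hxy' : x * y = 1) :
      aeval x (X ^ 2 - C c * X + 1) = x * (s - c) := by
    simp only [map_add, map_sub, map_mul, aeval_X_pow, aeval_C, aeval_X, map_one,
      algebraMap_int_eq, Int.coe_castRingHom]
    linear_combination x * hxy - hxy'
  apply hinj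
  rw [← aeval_mul_aeval_eq_normEval hs hp, haeval hs hp,
    haeval (add_comm v w ▸ hs) (mul_comm v w ▸ hp)]
  push_cast
  linear_combination (s - c : R) ^ 2 * hp

theorem normEval_cyclotomic_three (s : ℤ) : normEval s (cyclotomic 3 ℤ) = (s + 1) ^ 2 := by
  rw [cyclotomic_three, ← sub_neg_eq_add s, ← normEval_X_sq_sub]
  simp

theorem normEval_cyclotomic_six (s : ℤ) : normEval s (cyclotomic 6 ℤ) = (s - 1) ^ 2 := by
  rw [cyclotomic_six, ← normEval_X_sq_sub]
  simp

theorem normEval_cyclotomic_twelve (s : ℤ) : normEval s (cyclotomic 12 ℤ) = (s ^ 2 - 3) ^ 2 := by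
  rw [show 12 = 6 * 2 from rfl, ← cyclotomic_expand_eq_cyclotomic Nat.prime_two (by norm_num),
    normEval_expand, normEval_cyclotomic_six, ← mul_one 2, powTrace_two_mul, powTrace_one]
  ring

theorem exists_prime_dvd_not_dvd_twentyFour {c : ℤ} (h16 : (c : ZMod 16) ≠ 0)
    (h9 : (c : ZMod 9) ≠ 0) (h24 : ¬c ∣ 24) :
    ∃ q : ℕ, q.Prime ∧ (q : ℤ) ∣ c ∧ ¬q ∣ 24 := by
  rw [Ne, ZMod.intCast_zmod_eq_zero_iff_dvd, Int.natCast_dvd] at h16 h9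
  by_contra! hcon
  refine h24 (Int.natAbs_dvd.1 (Int.natCast_dvd_natCast (n := 24).2 ?_))
  rw [Nat.dvd_iff_prime_pow_dvd_dvd]
  intro q k hq hk
  rcases k.eq_zero_or_pos with rfl | hk0
  · simp
  have hq24 : q ∣ 2 ^ 3 * 3 :=
    hcon q hq (Int.natCast_dvd.2 ((dvd_pow_self q hk0.ne').trans hk))
  rcases (hq.dvd_mul).1 hq24 with h2 | h3
  · obtain rfl := (Nat.prime_dvd_prime_iff_eq hq Nat.prime_two).1 (hq.dvd_of_dvd_pow h2)
    have : k ≤ 3 := by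
      by_contra! hk4
      exact h16 ((pow_dvd_pow 2 hk4).trans hk)
    exact (pow_dvd_pow 2 this).trans (by norm_num)
  · obtain rfl := (Nat.prime_dvd_prime_iff_eq hq Nat.prime_three).1 h3
    have : k ≤ 1 := by
      by_contra! hk2
      exact h9 ((pow_dvd_pow 3 hk2).trans hk)
    exact (pow_dvd_pow 3 this).trans (by norm_num)

theorem exists_prime_dvd_normEval_cyclotomic_two (ha : 1 ≤ a) (h2 : a ≠ 2) :
    ∃ q : ℕ, q.Prime ∧ (q : ℤ) ∣ normEval (a ^ 2 + 2) (cyclotomic 2 ℤ) ∧ ¬q ∣ 24 := by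
  rw [cyclotomic_two, normEval_X_add_one]
  refine exists_prime_dvd_not_dvd_twentyFour ?_ ?_ fun h => ?_
  · push_cast
    generalize (a : ZMod 16) = b
    decide +revert
  · push_cast
    generalize (a : ZMod 9) = b
    decide +revert
  · have := Int.le_of_dvd (by norm_num) h
    have : a < 5 := by nlinarith
    interval_cases a <;> lia

theorem exists_prime_dvd_normEval_cyclotomic_six (ha : 2 ≤ a) :
    ∃ q : ℕ, q.Prime ∧ (q : ℤ) ∣ normEval (a ^ 2 + 2) (cyclotomic 6 ℤ) ∧ ¬q ∣ 24 := by
  obtain ⟨q, hq, hqa, hq24⟩ : ∃ q : ℕ, q.Prime ∧ (q : ℤ) ∣ a ^ 2 + 2 - 1 ∧ ¬q ∣ 24 := by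
    refine exists_prime_dvd_not_dvd_twentyFour ?_ ?_ fun h => ?_
    · push_cast
      generalize (a : ZMod 16) = b
      decide +revert
    · push_cast
      generalize (a : ZMod 9) = b
      decide +revert
    · have := Int.le_of_dvd (by norm_num) h
      have : a < 5 := by nlinarith
      interval_cases a <;> lia
  exact ⟨q, hq, normEval_cyclotomic_six _ ▸ dvd_pow hqa two_ne_zero, hq24⟩

theorem exists_prime_dvd_normEval_cyclotomic_twelve (ha : 2 ≤ a) :
    ∃ q : ℕ, q.Prime ∧ (q : ℤ) ∣ normEval (a ^ 2 + 2) (cyclotomic 12 ℤ) ∧ ¬q ∣ 24 := by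
  obtain ⟨q, hq, hqa, hq24⟩ : ∃ q : ℕ, q.Prime ∧ (q : ℤ) ∣ (a ^ 2 + 2) ^ 2 - 3 ∧ ¬q ∣ 24 := by
    refine exists_prime_dvd_not_dvd_twentyFour ?_ ?_ fun h => ?_
    · push_cast
      generalize (a : ZMod 16) = b
      decide +revert
    · push_cast
      generalize (a : ZMod 9) = b
      decide +revert
    · have := Int.le_of_dvd (by norm_num) h
      nlinarith [mul_self_nonneg (a ^ 2 - 4)]
  exact ⟨q, hq, normEval_cyclotomic_twelve _ ▸ dvd_pow hqa two_ne_zero, hq24⟩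

end ExistsPrime

/-- The indices `m ≥ 1` for which every prime dividing `N(vᵐ - 1)` divides some `N(vʲ - 1)` with
`1 ≤ j < m`, where `v` has norm `1` and trace `a² + 2` and `a ≥ 1`. -/
def exceptionalIndices (a : ℤ) : Finset ℕ :=
  if a = 1 then {1, 6, 10, 12} else if a = 2 then {2} else ∅

section Zsigmondy

variable {s a : ℤ} {m n p q : ℕ}

theorem eq_six_or_twelve_of_lt (hm : m ≠ 0) (hp : p.Prime) (hq : q.Prime) (hpq : p < q)
    (hpN : (p : ℤ) ∣ normEval s (cyclotomic m ℤ)) (hqN : (q : ℤ) ∣ normEval s (cyclotomic m ℤ))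
    (hpm : p ∣ m) (hqm : q ∣ m) : m = 6 ∨ m = 12 := by
  obtain ⟨i, n, hn, rfl⟩ := Nat.exists_eq_pow_mul_and_not_dvd hm p hp.ne_one
  have hqn : q ∣ n :=
    (((Nat.coprime_primes hq hp).2 hpq.ne').pow_right i).dvd_of_dvd_mul_left hqm
  have hnp : n ∣ p - 1 ∨ n ∣ p + 1 := dvd_sub_one_or_dvd_add_one hp hn hpN
  have hp2 := hp.two_le
  have hqp : q = p + 1 := by
    rcases hnp with h | h
    all_goals
      have := Nat.le_of_dvd (by lia) (hqn.trans h)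
      lia
  obtain rfl : p = 2 := by
    rcases hp.eq_two_or_odd with h | h
    · exact h
    · rcases hq.eq_two_or_odd with h' | h' <;> lia
  subst hqp
  obtain rfl : n = 3 := by
    refine Nat.dvd_antisymm (hnp.resolve_left fun h => ?_) hqn
    exact absurd (Nat.le_of_dvd one_pos (hqn.trans h)) (by lia)
  have hi : 2 ^ i ∣ 3 - 1 ∨ 2 ^ i ∣ 3 + 1 :=
    dvd_sub_one_or_dvd_add_one (i := 1) hq
      (fun h => absurd (Nat.le_of_dvd two_pos (hq.dvd_of_dvd_pow h)) (by lia))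
      (by rwa [pow_one, mul_comm])
  have hi2 : 2 ^ i ∣ 2 ^ 2 := hi.elim (fun h => h.trans (by norm_num)) id
  have : i ≤ 2 := (Nat.pow_dvd_pow_iff_le_right (by norm_num)).1 hi2
  interval_cases i <;> simp_all

theorem eq_six_or_twelve (hm : m ≠ 0) (hp : p.Prime) (hq : q.Prime) (hpq : p ≠ q)
    (hpN : (p : ℤ) ∣ normEval s (cyclotomic m ℤ)) (hqN : (q : ℤ) ∣ normEval s (cyclotomic m ℤ))
    (hpm : p ∣ m) (hqm : q ∣ m) : m = 6 ∨ m = 12 := by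
  rcases hpq.lt_or_gt with h | h
  · exact eq_six_or_twelve_of_lt hm hp hq h hpN hqN hpm hqm
  · exact eq_six_or_twelve_of_lt hm hq hp h hqN hpN hqm hpm

theorem eq_two_or_six_of_not_four_dvd (h2 : 2 ∣ m) (h4 : ¬4 ∣ m)
    (h : 2 ∣ normEval s (cyclotomic m ℤ)) : m = 2 ∨ m = 6 := by
  obtain ⟨n, rfl⟩ := h2
  have hn3 : n ∣ 3 := by
    rcases dvd_sub_one_or_dvd_add_one Nat.prime_two (i := 1) (m := n) (by lia) (by simpa using h)
      with h | h
    · exact h.trans (one_dvd 3)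
    · exact h
  rcases (Nat.dvd_prime Nat.prime_three).1 hn3 with rfl | rfl <;> simp

theorem not_prime_cube_dvd_normEval_cyclotomic (hp : p.Prime) (hm : m ≠ 0) (hpm : p ∣ m)
    (h2 : m ≠ 2) (h6 : m ≠ 6) : ¬(p : ℤ) ^ 3 ∣ normEval (a ^ 2 + 2) (cyclotomic m ℤ) := by
  intro h
  obtain ⟨n, rfl⟩ := hpm
  by_cases hp2 : p = 2
  · subst hp2
    have hdvd : (2 : ℤ) ∣ normEval (a ^ 2 + 2) (cyclotomic (2 * n) ℤ) :=
      (dvd_pow_self _ three_ne_zero).trans h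
    by_cases h4 : 4 ∣ 2 * n
    · obtain ⟨k, hk⟩ := h4
      rw [hk] at h
      exact not_eight_dvd_normEval_cyclotomic (by lia) h
    · rcases eq_two_or_six_of_not_four_dvd (Dvd.intro n rfl) h4 hdvd with h | h
      · exact h2 h
      · exact h6 h
  · rw [mul_comm] at h
    exact not_prime_cube_dvd_normEval_cyclotomic_mul hp hp2 (right_ne_zero_of_mul hm) h

theorem exists_prime_abs_normEval_cyclotomic_le_sq (ha : 1 ≤ a) (hm : 2 < m) (h6 : m ≠ 6)
    (h12 : m ≠ 12)
    (h : ∀ q : ℕ, q.Prime → (q : ℤ) ∣ normEval (a ^ 2 + 2) (cyclotomic m ℤ) → q ∣ m) :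
    ∃ p : ℕ, p.Prime ∧ p ∣ m ∧ (p : ℤ) ∣ normEval (a ^ 2 + 2) (cyclotomic m ℤ) ∧
      |normEval (a ^ 2 + 2) (cyclotomic m ℤ)| ≤ p ^ 2 := by
  have hlt := sub_two_pow_totient_lt (s := a ^ 2 + 2) (by nlinarith) hm.le
  set N := normEval (a ^ 2 + 2) (cyclotomic m ℤ) with hN
  have h1 : 1 < N.natAbs := by
    rw [← Nat.cast_lt (α := ℤ), Int.natCast_natAbs, Nat.cast_one]
    exact (one_le_pow₀ (by nlinarith)).trans_lt hlt
  obtain ⟨p, hp, hpN⟩ := Nat.exists_prime_and_dvd h1.ne'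
  have hpm := h p hp (Int.natCast_dvd.2 hpN)
  refine ⟨p, hp, hpm, Int.natCast_dvd.2 hpN, ?_⟩
  have hpow := Nat.eq_prime_pow_of_unique_prime_dvd (p := p) h1.ne_bot fun {q} hq hqN => by
    by_contra hne
    have hqN' : (q : ℤ) ∣ N := Int.natCast_dvd.2 hqN
    exact (eq_six_or_twelve (by lia) hp hq (Ne.symm hne) (Int.natCast_dvd.2 hpN) hqN' hpm
      (h q hq hqN')).elim h6 h12
  generalize N.natAbs.primeFactorsList.length = e at hpow
  have he : e ≤ 2 := by
    by_contra! he
    refine not_prime_cube_dvd_normEval_cyclotomic (a := a) hp (by lia) hpm hm.ne' h6 ?_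
    rw [← hN, ← Nat.cast_pow, Int.natCast_dvd, hpow]
    exact pow_dvd_pow p he
  rw [← Int.natCast_natAbs, hpow]
  exact_mod_cast Nat.pow_le_pow_right hp.pos he

theorem sq_le_pow_totient {b : ℤ} (hb : 4 ≤ b) (hm : m ≠ 0) (hp : p.Prime) (hpm : p ∣ m) :
    (p : ℤ) ^ 2 ≤ b ^ m.totient := by
  have htot : p - 1 ≤ m.totient := by
    rw [← Nat.totient_prime hp]
    exact Nat.le_of_dvd (Nat.totient_pos.2 (by lia)) (Nat.totient_dvd_of_dvd hpm)
  have hpow : p ≤ 2 ^ (p - 1) := by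
    have := Nat.lt_two_pow_self (n := p - 1)
    lia
  calc (p : ℤ) ^ 2 ≤ (2 ^ (p - 1)) ^ 2 := by gcongr; exact_mod_cast hpow
    _ = 4 ^ (p - 1) := by rw [pow_right_comm]; norm_num
    _ ≤ 4 ^ m.totient := by gcongr; norm_num
    _ ≤ b ^ m.totient := by gcongr

theorem exists_prime_dvd_of_two_le (ha : 2 ≤ a) (hm : 2 < m) (h6 : m ≠ 6) (h12 : m ≠ 12) :
    ∃ q : ℕ, q.Prime ∧ (q : ℤ) ∣ normEval (a ^ 2 + 2) (cyclotomic m ℤ) ∧ ¬q ∣ m := by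
  by_contra! hcon
  obtain ⟨p, hp, hpm, -, hle⟩ :=
    exists_prime_abs_normEval_cyclotomic_le_sq (by lia) hm h6 h12 hcon
  have hlt := sub_two_pow_totient_lt (s := a ^ 2 + 2) (by nlinarith) hm.le
  have := sq_le_pow_totient (b := a ^ 2 + 2 - 2) (by nlinarith) (by lia) hp hpm
  lia

theorem powTrace_three_growth (hn : 2 ≤ n) :
    7 ≤ powTrace 3 n ∧ 2 * powTrace 3 n ≤ powTrace 3 (n + 1) := by
  induction n, hn using Nat.le_induction with
  | base => simp [powTrace_add_two, powTrace_one, powTrace_zero]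
  | succ n hn ih =>
    rw [powTrace_add_two]
    lia

theorem five_mul_sq_lt_powTrace_three (hn : 7 ≤ n) : 5 * (n : ℤ) ^ 2 < powTrace 3 n - 2 := by
  induction n, hn using Nat.le_induction with
  | base => simp [powTrace_add_two, powTrace_one, powTrace_zero]
  | succ n hn ih =>
    have := (powTrace_three_growth (n := n) (by lia)).2
    push_cast
    nlinarith

theorem sq_mul_five_pow_lt {k : ℕ} (hk : 2 ≤ k ∨ 7 ≤ p) (hk0 : k ≠ 0) (hp : 5 ≤ p)
    (hp6 : p ≠ 6) : (p : ℤ) ^ 2 * 5 ^ k < (powTrace 3 p - 2) ^ k := by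
  obtain rfl | hp7 : p = 5 ∨ 7 ≤ p := by lia
  · have h5 : powTrace 3 5 = 123 := by norm_num [powTrace_add_two, powTrace_one, powTrace_zero]
    rw [Nat.cast_ofNat, h5]
    calc (5 : ℤ) ^ 2 * 5 ^ k ≤ 5 ^ k * 5 ^ k := by
          gcongr
          · norm_num
          · exact hk.resolve_right (by norm_num)
      _ = 25 ^ k := by rw [← mul_pow]; norm_num
      _ < (123 - 2) ^ k := by
          gcongr
          norm_num
  · calc (p : ℤ) ^ 2 * 5 ^ k ≤ ((p : ℤ) ^ 2) ^ k * 5 ^ k := by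
          gcongr
          exact le_self_pow₀ (one_le_pow₀ (by lia)) hk0
      _ = (5 * (p : ℤ) ^ 2) ^ k := by rw [← mul_pow, mul_comm]
      _ < (powTrace 3 p - 2) ^ k := by
          gcongr
          exact five_mul_sq_lt_powTrace_three hp7

theorem normEval_three_cyclotomic_five : normEval 3 (cyclotomic 5 ℤ) = 11 ^ 2 := by
  have : Fact (Nat.Prime 5) := ⟨Nat.prime_five⟩
  rw [cyclotomic_prime, normEval_geom_sum_odd 3 2]
  norm_num [Finset.sum_range_succ, powTrace_add_two, powTrace_one, powTrace_zero]

theorem not_dvd_of_abs_normEval_three_le_sq (hp : p.Prime) (hn : n ≠ 0)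
    (hle : |normEval 3 (cyclotomic (n * p) ℤ)| ≤ p ^ 2) : ¬p ∣ n := by
  intro hpn
  have hC := (powTrace_three_growth hp.two_le).1
  have hlow := powTrace_sub_two_pow_totient_le_of_dvd hp (by lia) hpn (s := 3) (by lia)
  have h4 := sq_le_pow_totient (b := 4) le_rfl hn hp hpn
  have h45 : (4 : ℤ) ^ n.totient < (powTrace 3 p - 2) ^ n.totient :=
    pow_lt_pow_left₀ (by lia) (by norm_num) (Nat.totient_pos.2 (by lia)).ne'
  lia

theorem mul_mem_of_abs_normEval_three_le_sq (hp : p.Prime) (hn : n ≠ 0)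
    (hpN : (p : ℤ) ∣ normEval 3 (cyclotomic (n * p) ℤ))
    (hle : |normEval 3 (cyclotomic (n * p) ℤ)| ≤ p ^ 2) :
    n * p ∈ ({2, 3, 5, 6, 10, 12} : Finset ℕ) := by
  have hpn := not_dvd_of_abs_normEval_three_le_sq hp hn hle
  have hdvd : n ∣ p - 1 ∨ n ∣ p + 1 :=
    dvd_sub_one_or_dvd_add_one (i := 1) hp hpn (by rwa [pow_one, mul_comm])
  have hlt : ¬(p : ℤ) ^ 2 * 5 ^ n.totient < (powTrace 3 p - 2) ^ n.totient := by
    have hC := (powTrace_three_growth hp.two_le).1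
    have hlow := powTrace_sub_two_pow_totient_le_of_not_dvd hp (by lia) hpn (s := 3) (by lia)
    have hup := abs_normEval_cyclotomic_le (s := 3) (by norm_num) (Nat.pos_of_ne_zero hn)
    rw [not_lt]
    exact hlow.trans (by gcongr; simpa using hup)
  have hp6 : p ≠ 6 := by rintro rfl; norm_num at hp
  have hn0 : n.totient ≠ 0 := (Nat.totient_pos.2 (by lia)).ne'
  obtain rfl | rfl | hp5 : p = 2 ∨ p = 3 ∨ 5 ≤ p := by
    have := hp.two_le
    have hp4 : p ≠ 4 := by rintro rfl; norm_num at hp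
    lia
  · have : n ≤ 3 := Nat.le_of_dvd three_pos (hdvd.elim (fun h => h.trans (by norm_num)) id)
    interval_cases n <;> simp_all
  · have : n ≤ 4 := Nat.le_of_dvd four_pos (hdvd.elim (fun h => h.trans (by norm_num)) id)
    interval_cases n <;> simp_all
  · have hk : ¬(2 ≤ n.totient ∨ 7 ≤ p) := fun hk => hlt (sq_mul_five_pow_lt hk hn0 hp5 hp6)
    obtain rfl : p = 5 := by lia
    rcases Nat.totient_eq_one_iff.1 (by lia : n.totient = 1) with rfl | rfl <;> simp

theorem exists_prime_dvd_normEval_three (hm : 2 < m) (h6 : m ≠ 6) (h10 : m ≠ 10)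
    (h12 : m ≠ 12) :
    ∃ q : ℕ, q.Prime ∧ (q : ℤ) ∣ normEval 3 (cyclotomic m ℤ) ∧ ¬q ∣ m := by
  by_contra! hcon
  obtain ⟨p, hp, ⟨n, rfl⟩, hpN, hle⟩ :=
    exists_prime_abs_normEval_cyclotomic_le_sq (a := 1) le_rfl hm h6 h12 hcon
  norm_num only at hpN hle hcon
  rw [mul_comm] at *
  have hmem := mul_mem_of_abs_normEval_three_le_sq hp (by lia) hpN hle
  obtain h3 | h5 : n * p = 3 ∨ n * p = 5 := by
    simp only [Finset.mem_insert, Finset.mem_singleton] at hmem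
    lia
  · rw [h3] at hcon
    exact absurd (hcon 2 Nat.prime_two (by rw [normEval_cyclotomic_three]; norm_num)) (by norm_num)
  · rw [h5] at hcon
    exact absurd (hcon 11 (by norm_num) (by rw [normEval_three_cyclotomic_five]; norm_num))
      (by norm_num)

theorem exists_prime_dvd_normEval_cyclotomic_one (ha : 2 ≤ a) :
    ∃ q : ℕ, q.Prime ∧ (q : ℤ) ∣ normEval (a ^ 2 + 2) (cyclotomic 1 ℤ) ∧ ¬q ∣ 1 := by
  obtain ⟨q, hq, hqa⟩ := Nat.exists_prime_and_dvd (n := a.natAbs) (by lia)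
  refine ⟨q, hq, ?_, hq.not_dvd_one⟩
  rw [cyclotomic_one, normEval_X_sub_one, sub_add_cancel_right, dvd_neg]
  exact dvd_pow (Int.natCast_dvd.2 hqa) two_ne_zero

theorem exists_prime_dvd_normEval_cyclotomic (ha : 1 ≤ a) (hm : 0 < m)
    (h : m ∉ exceptionalIndices a) :
    ∃ q : ℕ, q.Prime ∧ (q : ℤ) ∣ normEval (a ^ 2 + 2) (cyclotomic m ℤ) ∧ ¬q ∣ m := by
  have of_dvd (h24 : m ∣ 24) (hex : ∃ q : ℕ, q.Prime ∧
      (q : ℤ) ∣ normEval (a ^ 2 + 2) (cyclotomic m ℤ) ∧ ¬q ∣ 24) :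
      ∃ q : ℕ, q.Prime ∧ (q : ℤ) ∣ normEval (a ^ 2 + 2) (cyclotomic m ℤ) ∧ ¬q ∣ m :=
    hex.imp fun q ⟨hq, hqN, hq24⟩ => ⟨hq, hqN, fun hqm => hq24 (hqm.trans h24)⟩
  obtain rfl | ha2 : a = 1 ∨ 2 ≤ a := by lia
  · simp only [exceptionalIndices, if_true, Finset.mem_insert, Finset.mem_singleton, not_or] at h
    obtain rfl | hm2 : m = 2 ∨ 2 < m := by lia
    · exact of_dvd (by norm_num) (exists_prime_dvd_normEval_cyclotomic_two le_rfl (by norm_num))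
    · exact exists_prime_dvd_normEval_three hm2 h.2.1 h.2.2.1 h.2.2.2
  by_cases h6 : m = 6
  · subst h6
    exact of_dvd (by norm_num) (exists_prime_dvd_normEval_cyclotomic_six ha2)
  by_cases h12 : m = 12
  · subst h12
    exact of_dvd (by norm_num) (exists_prime_dvd_normEval_cyclotomic_twelve ha2)
  obtain rfl | rfl | hm2 : m = 1 ∨ m = 2 ∨ 2 < m := by lia
  · exact exists_prime_dvd_normEval_cyclotomic_one ha2
  · refine of_dvd (by norm_num) (exists_prime_dvd_normEval_cyclotomic_two ha ?_)
    rintro rfl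
    simp [exceptionalIndices] at h
  · exact exists_prime_dvd_of_two_le ha2 hm2 h6 h12

end Zsigmondy

section Subsequence

variable {P : ℕ → Prop} {A : ℕ → ℤ} {n : ℕ}

/-- The indices `k` satisfying `P` for which every prime divisor of `A k` divides an earlier nonzero
`A j` with `P j`: the failure set of the subsequence of `A` indexed by `P`, before renumbering. -/
def failuresAlong (P : ℕ → Prop) (A : ℕ → ℤ) : Set ℕ :=
  {k | P k ∧ ∀ p : ℕ, p.Prime → (p : ℤ) ∣ A k → ∃ j < k, P j ∧ A j ≠ 0 ∧ (p : ℤ) ∣ A j}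

theorem succ_mem_failureSet_nth_iff (hP : (Set.ofPred P).Infinite) :
    n + 1 ∈ failureSet (fun n => A (Nat.nth P (n - 1))) ↔ Nat.nth P n ∈ failuresAlong P A := by
  classical
  simp only [failureSet, IsPrimitivePrimeDivisor, failuresAlong, Set.mem_ofPred_eq,
    Nat.le_add_left, true_and, Nat.nth_mem_of_infinite hP, Nat.add_sub_cancel]
  push Not
  refine forall₂_congr fun p _ => imp_congr_right fun _ => ⟨?_, ?_⟩
  · rintro ⟨i, hi, hin, hA, hpA⟩
    exact ⟨_, Nat.nth_strictMono hP (by lia), Nat.nth_mem_of_infinite hP _, hA, hpA⟩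
  · rintro ⟨j, hjn, hPj, hA, hpA⟩
    rw [← Nat.nth_count hPj] at hA hpA hjn
    have := (Nat.nth_strictMono hP).lt_iff_lt.1 hjn
    exact ⟨Nat.count P j + 1, by lia, by lia, hA, hpA⟩

theorem failureSet_nth [DecidablePred P] (hP : (Set.ofPred P).Infinite) :
    failureSet (fun n => A (Nat.nth P (n - 1))) =
      (fun k => Nat.count P k + 1) '' failuresAlong P A := by
  ext n
  constructor
  · intro h
    obtain ⟨n, rfl⟩ := Nat.exists_eq_add_of_le' h.1
    exact ⟨_, (succ_mem_failureSet_nth_iff hP).1 h, by simp [Nat.count_nth_of_infinite hP]⟩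
  · rintro ⟨k, hk, rfl⟩
    rw [succ_mem_failureSet_nth_iff hP, Nat.nth_count hk.1]
    exact hk

end Subsequence

section RemoveTwoModFour

variable {A : ℕ → ℤ} {a : ℤ} {m j k p : ℕ}

/-- The index of the retained term whose prime divisors are those of `N(u²ᵐ - 1)`, where
`N(u) = -1`: for odd `m` the term of index `2 m` is removed, but it equals `-N(uᵐ - 1)²`. -/
def keptIndex (m : ℕ) : ℕ :=
  if Odd m then m else 2 * m

theorem one_le_keptIndex_and (hm : 0 < m) : 1 ≤ keptIndex m ∧ keptIndex m % 4 ≠ 2 := by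
  unfold keptIndex
  split_ifs <;> grind

theorem exists_keptIndex_eq (hk : 1 ≤ k ∧ k % 4 ≠ 2) : ∃ m, 0 < m ∧ keptIndex m = k := by
  obtain h | ⟨i, rfl⟩ : Odd k ∨ 4 ∣ k := by grind
  · exact ⟨k, hk.1, if_pos h⟩
  · exact ⟨2 * i, by lia, by rw [keptIndex, if_neg (by grind)]; ring⟩

theorem keptIndex_le_of_dvd (hj : 0 < j) (h : m ∣ j) : keptIndex m ≤ keptIndex j := by
  have hle := Nat.le_of_dvd hj h
  have hodd (hj : Odd j) : Odd m := hj.of_dvd_nat h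
  unfold keptIndex
  split_ifs <;> grind

theorem infinite_one_le_and_mod_four_ne_two :
    (Set.ofPred fun k : ℕ => 1 ≤ k ∧ k % 4 ≠ 2).Infinite :=
  Set.infinite_of_injective_forall_mem (f := fun b : ℕ => 4 * b + 1) (fun _ _ h => by grind)
    fun _ => ⟨by lia, by lia⟩

theorem exists_prime_dvd_iff_dvd (ha : 1 ≤ a) (hm : 0 < m) (h : m ∉ exceptionalIndices a) :
    ∃ p : ℕ, p.Prime ∧ ∀ j, (p : ℤ) ∣ normEval (a ^ 2 + 2) (X ^ j - 1) ↔ m ∣ j := by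
  obtain ⟨p, hp, hpN, hpm⟩ := exists_prime_dvd_normEval_cyclotomic ha hm h
  exact ⟨p, hp, dvd_normEval_X_pow_sub_one_iff hp hpm hpN⟩

theorem exists_keptIndex_lt_of_mem_exceptionalIndices (hm : m ∈ exceptionalIndices a)
    (hp : p.Prime) (hpm : (p : ℤ) ∣ normEval (a ^ 2 + 2) (X ^ m - 1)) :
    ∃ j, 0 < j ∧ keptIndex j < keptIndex m ∧ normEval (a ^ 2 + 2) (X ^ j - 1) ≠ 0 ∧
      (p : ℤ) ∣ normEval (a ^ 2 + 2) (X ^ j - 1) := by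
  simp only [normEval_X_pow_sub_one] at *
  by_cases hne : a = 1 ∧ m = 1
  · obtain ⟨rfl, rfl⟩ := hne
    refine absurd (Int.natCast_dvd_natCast.1 (hpm.trans ?_)) hp.not_dvd_one
    norm_num [powTrace_one]
  obtain ⟨i, j, ⟨hi, him⟩, ⟨hj, hjm⟩, hi0, hj0, h⟩ : ∃ i j,
      (0 < i ∧ keptIndex i < keptIndex m) ∧ (0 < j ∧ keptIndex j < keptIndex m) ∧
      2 - powTrace (a ^ 2 + 2) i ≠ 0 ∧ 2 - powTrace (a ^ 2 + 2) j ≠ 0 ∧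
      2 - powTrace (a ^ 2 + 2) m ∣
        ((2 - powTrace (a ^ 2 + 2) i) * (2 - powTrace (a ^ 2 + 2) j)) ^ 3 := by
    unfold exceptionalIndices at hm
    split_ifs at hm with h1 h2
    · subst h1
      simp only [Finset.mem_insert, Finset.mem_singleton] at hm
      rcases hm with rfl | rfl | rfl | rfl
      · exact absurd ⟨rfl, rfl⟩ hne
      · exact ⟨2, 3, by decide, by decide, by
          norm_num [powTrace_add_two, powTrace_one, powTrace_zero]⟩
      · exact ⟨2, 5, by decide, by decide, by
          norm_num [powTrace_add_two, powTrace_one, powTrace_zero]⟩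
      · exact ⟨3, 4, by decide, by decide, by
          norm_num [powTrace_add_two, powTrace_one, powTrace_zero]⟩
    · subst h2
      obtain rfl := Finset.mem_singleton.1 hm
      exact ⟨1, 1, by decide, by decide, by
        norm_num [powTrace_add_two, powTrace_one, powTrace_zero]⟩
    · simp at hm
  have hp' := Nat.prime_iff_prime_int.1 hp
  rcases hp'.dvd_or_dvd (hp'.dvd_of_dvd_pow (hpm.trans h)) with h | h
  · exact ⟨i, hi, him, hi0, h⟩
  · exact ⟨j, hj, hjm, hj0, h⟩

theorem pos_of_mem_exceptionalIndices (hm : m ∈ exceptionalIndices a) : 0 < m := by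
  refine Nat.pos_of_ne_zero ?_
  rintro rfl
  unfold exceptionalIndices at hm
  split_ifs at hm <;> simp at hm

theorem failuresAlong_eq_image_keptIndex (ha : 1 ≤ a)
    (heven : ∀ m, A (2 * m) = normEval (a ^ 2 + 2) (X ^ m - 1))
    (hodd : ∀ m, Odd m → A (2 * m) = -A m ^ 2) :
    failuresAlong (fun k => 1 ≤ k ∧ k % 4 ≠ 2) A = keptIndex '' exceptionalIndices a := by
  have hdvd {p m : ℕ} (hp : p.Prime) :
      (p : ℤ) ∣ A (keptIndex m) ↔ (p : ℤ) ∣ normEval (a ^ 2 + 2) (X ^ m - 1) := by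
    rw [keptIndex, ← heven]
    split_ifs with h
    · rw [hodd m h, dvd_neg, (Nat.prime_iff_prime_int.1 hp).dvd_pow_iff_dvd two_ne_zero]
    · rfl
  have hne {m : ℕ} (h : normEval (a ^ 2 + 2) (X ^ m - 1) ≠ 0) : A (keptIndex m) ≠ 0 := by
    rw [← heven] at h
    rw [keptIndex]
    split_ifs with hm
    · exact fun h0 => h (by rw [hodd m hm, h0]; norm_num)
    · exact h
  ext k
  constructor
  · rintro ⟨hk, hkA⟩
    obtain ⟨m, hm, rfl⟩ := exists_keptIndex_eq hk
    refine ⟨m, ?_, rfl⟩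
    by_contra hmem
    obtain ⟨p, hp, hpiff⟩ := exists_prime_dvd_iff_dvd ha hm hmem
    obtain ⟨j, hjm, hj, -, hpj⟩ := hkA p hp ((hdvd hp).2 ((hpiff m).2 dvd_rfl))
    obtain ⟨j, hj0, rfl⟩ := exists_keptIndex_eq hj
    exact hjm.not_ge (keptIndex_le_of_dvd hj0 ((hpiff j).1 ((hdvd hp).1 hpj)))
  · rintro ⟨m, hm, rfl⟩
    have hm0 := pos_of_mem_exceptionalIndices hm
    refine ⟨one_le_keptIndex_and hm0, fun p hp hpm => ?_⟩
    obtain ⟨j, hj, hjm, hj0, hpj⟩ :=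
      exists_keptIndex_lt_of_mem_exceptionalIndices hm hp ((hdvd hp).1 hpm)
    exact ⟨keptIndex j, hjm, one_le_keptIndex_and hj, hne hj0, (hdvd hp).2 hpj⟩

theorem failureSet_removeTwoModFour (ha : 1 ≤ a)
    (heven : ∀ m, A (2 * m) = normEval (a ^ 2 + 2) (X ^ m - 1))
    (hodd : ∀ m, Odd m → A (2 * m) = -A m ^ 2) :
    failureSet (removeTwoModFour A) =
      if a = 1 then {1, 9, 15, 18} else if a = 2 then {3} else ∅ := by
  have h := failureSet_nth (A := A) infinite_one_le_and_mod_four_ne_two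
  rw [failuresAlong_eq_image_keptIndex ha heven hodd, ← Set.image_comp] at h
  refine h.trans ?_
  unfold exceptionalIndices
  split_ifs
  · simp only [Finset.coe_insert, Finset.coe_singleton, Set.image_insert_eq, Set.image_singleton]
    rfl
  · rw [Finset.coe_singleton, Set.image_singleton]
    rfl
  · simp

end RemoveTwoModFour

section RankTwo

variable {R S : Type*} [CommRing R] [CommRing S] [Algebra R S]

theorem sq_eq_trace_smul_sub_algebraMap_norm (b : Module.Basis (Fin 2) R S) (v : S) :
    v ^ 2 = Algebra.trace R S v • v - algebraMap R S (Algebra.norm R v) := by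
  apply Algebra.leftMulMatrix_injective b
  have h := Matrix.aeval_self_charpoly (Algebra.leftMulMatrix b v)
  nontriviality R
  rw [Matrix.charpoly_fin_two, ← Algebra.norm_eq_matrix_det, ← Algebra.trace_eq_matrix_trace] at h
  simp only [map_add, map_sub, map_mul, aeval_X_pow, aeval_X, aeval_C] at h
  rw [map_sub, map_smul, map_pow, AlgHom.commutes, Algebra.smul_def]
  rw [← sub_eq_zero, ← h]
  abel

theorem norm_smul_one_add_smul (b : Module.Basis (Fin 2) R S) (v : S) (x y : R) :
    Algebra.norm R (x • 1 + y • v) =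
      x ^ 2 + x * y * Algebra.trace R S v + y ^ 2 * Algebra.norm R v := by
  rw [Algebra.norm_eq_matrix_det b, Algebra.norm_eq_matrix_det b, Algebra.trace_eq_matrix_trace b,
    map_add, map_smul, map_smul, map_one, Matrix.det_fin_two, Matrix.det_fin_two,
    Matrix.trace_fin_two]
  simp only [Matrix.add_apply, Matrix.smul_apply, smul_eq_mul, Matrix.one_apply_eq,
    Matrix.one_apply_ne, ne_eq, zero_ne_one, one_ne_zero, not_false_eq_true]
  ring

theorem algebraMap_norm_eq_self (b : Module.Basis (Fin 1) R S) (v : S) :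
    algebraMap R S (Algebra.norm R v) = v := by
  apply Algebra.leftMulMatrix_injective b
  rw [AlgHom.commutes, Algebra.norm_eq_matrix_det b, Matrix.det_fin_one]
  ext i j
  rw [Subsingleton.elim i 0, Subsingleton.elim j 0]
  simp [Matrix.algebraMap_matrix_apply]

theorem norm_sq_sub_one (b : Module.Basis (Fin 2) R S) {u : S} (hu : Algebra.norm R u = -1) :
    Algebra.norm R (u ^ 2 - 1) = -Algebra.norm R (u - 1) ^ 2 := by
  have hadd := norm_smul_one_add_smul b u 1 1
  have hsub := norm_smul_one_add_smul b u (-1) 1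
  simp only [neg_smul, one_smul, neg_add_eq_sub, add_comm 1 u] at hadd hsub
  rw [show u ^ 2 - 1 = (u + 1) * (u - 1) by ring, map_mul, hadd, hsub, hu]
  ring

theorem trace_sq (b : Module.Basis (Fin 2) R S) (u : S) :
    Algebra.trace R S (u ^ 2) = Algebra.trace R S u ^ 2 - 2 * Algebra.norm R u := by
  rw [sq_eq_trace_smul_sub_algebraMap_norm b, map_sub, map_smul,
    Algebra.trace_algebraMap_of_basis b]
  simp [sq]

theorem norm_aeval_eq_normEval {S : Type*} [CommRing S] (b : Module.Basis (Fin 2) ℤ S) {v : S}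
    (hv : Algebra.norm ℤ v = 1) (f : ℤ[X]) :
    Algebra.norm ℤ (aeval v f) = normEval (Algebra.trace ℤ S v) f := by
  have hvv : v * v = (-1 : ℤ) • (1 : S) + Algebra.trace ℤ S v • v := by
    rw [← sq, sq_eq_trace_smul_sub_algebraMap_norm b, hv, map_one, neg_one_smul, neg_add_eq_sub]
  let φ := QuadraticAlgebra.lift (R := ℤ) ⟨v, hvv⟩
  have hnorm (z) : Algebra.norm ℤ (φ z) = z.norm := by
    have hz : φ z = z.re • (1 : S) + z.im • v := by
      simp [φ, QuadraticAlgebra.lift, Algebra.smul_def]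
    rw [hz, norm_smul_one_add_smul b, hv, norm_def]
    ring
  have hω : φ ω = v := by simp [φ, QuadraticAlgebra.lift]
  calc Algebra.norm ℤ (aeval v f) = Algebra.norm ℤ (φ (aeval ω f)) := by
        rw [← aeval_algHom_apply φ, hω]
    _ = normEval (Algebra.trace ℤ S v) f := hnorm _

theorem failureSet_removeTwoModFour_norm_pow_sub_one {S : Type*} [CommRing S]
    (b : Module.Basis (Fin 2) ℤ S) {u : S} (hu : Algebra.norm ℤ u = -1)
    (htr : 1 ≤ Algebra.trace ℤ S u) :
    failureSet (removeTwoModFour fun n => Algebra.norm ℤ (u ^ n - 1)) =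
      if Algebra.trace ℤ S u = 1 then {1, 9, 15, 18}
      else if Algebra.trace ℤ S u = 2 then {3} else ∅ := by
  refine failureSet_removeTwoModFour htr (fun m => ?_) fun m hm => ?_
  · have htr_sq : Algebra.trace ℤ S (u ^ 2) = Algebra.trace ℤ S u ^ 2 + 2 := by
      rw [trace_sq b, hu]
      ring
    rw [← htr_sq, ← norm_aeval_eq_normEval b (by simp [hu])]
    simp [pow_mul]
  · rw [mul_comm, pow_mul]
    exact norm_sq_sub_one b (by rw [map_pow, hu, hm.neg_one_pow])

end RankTwo

theorem zsigmondyBound_of_isGreatest {A : ℕ → ℤ} {n : ℕ} (h : IsGreatest (failureSet A) n) :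
    zsigmondyBound A = n := by
  have hfin : (failureSet A).Finite := Set.finite_iff_bddAbove.2 h.bddAbove
  rw [zsigmondyBound, if_neg (Set.not_infinite.2 hfin), if_neg h.nonempty.ne_empty, h.csSup_eq]

theorem zsigmondyBound_of_failureSet_eq_empty {A : ℕ → ℤ} (h : failureSet A = ∅) :
    zsigmondyBound A = 1 := by
  rw [zsigmondyBound, if_neg (by simp [h]), if_pos h]

theorem eq_half_add_sqrt_iff {x c e : ℝ} (hx : 1 < x) (h : x ^ 2 = c * x + 1) :
    x = (e + √(e ^ 2 + 4)) / 2 ↔ c = e := by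
  constructor
  · intro hxe
    have hsq : √(e ^ 2 + 4) ^ 2 = e ^ 2 + 4 := Real.sq_sqrt (by positivity)
    rw [show √(e ^ 2 + 4) = 2 * x - e by linear_combination -2 * hxe] at hsq
    exact mul_right_cancel₀ (by positivity : x ≠ 0) (by linear_combination hsq / 4 - h)
  · rintro rfl
    rw [show c ^ 2 + 4 = (2 * x - c) ^ 2 by linear_combination -4 * h,
      Real.sqrt_sq (by nlinarith)]
    ring

theorem eq_one_add_sqrt_two_iff {x c : ℝ} (hx : 1 < x) (h : x ^ 2 = c * x + 1) :
    x = 1 + √2 ↔ c = 2 := by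
  rw [← eq_half_add_sqrt_iff hx h, show (2 : ℝ) ^ 2 + 4 = 2 ^ 2 * 2 by norm_num,
    Real.sqrt_mul (by norm_num), Real.sqrt_sq (by norm_num)]
  ring_nf

theorem eq_half_one_add_sqrt_five_iff {x c : ℝ} (hx : 1 < x) (h : x ^ 2 = c * x + 1) :
    x = (1 + √5) / 2 ↔ c = 1 := by
  rw [← eq_half_add_sqrt_iff hx h]
  norm_num

theorem theorem3p2_general {S : Type*} [CommRing S] [Module.Free ℤ S] [Module.Finite ℤ S]
    (hS : Module.finrank ℤ S = 2) (φ : S →+* ℝ) (u : S) (hu : Algebra.norm ℤ u = -1)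
    (hφu : 1 < φ u) (Δ' : ℕ → ℤ)
    (hΔ' : Δ' = removeTwoModFour fun n => Algebra.norm ℤ (u ^ n - 1)) :
    (φ u = 1 + √2 ∧ zsigmondyBound Δ' = 3 ∧ failureSet Δ' = {3}) ∨
    (φ u = (1 + √5) / 2 ∧ zsigmondyBound Δ' = 18 ∧ failureSet Δ' = {1, 9, 15, 18}) ∨
    (φ u ≠ 1 + √2 ∧ φ u ≠ (1 + √5) / 2 ∧ zsigmondyBound Δ' = 1 ∧ failureSet Δ' = ∅) := by
  let b := Module.finBasisOfFinrankEq ℤ S hS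
  set a := Algebra.trace ℤ S u
  have hx : φ u ^ 2 = a * φ u + 1 := by
    rw [← map_pow, sq_eq_trace_smul_sub_algebraMap_norm b, hu]
    simp [a]
  have ha : 1 ≤ a := by
    have : (0 : ℝ) < a := by nlinarith
    exact_mod_cast this
  have hset := failureSet_removeTwoModFour_norm_pow_sub_one b hu ha
  rw [← hΔ'] at hset
  rw [Ne, Ne, eq_one_add_sqrt_two_iff hφu hx, eq_half_one_add_sqrt_five_iff hφu hx]
  norm_cast
  obtain h1 | h2 | h3 : a = 1 ∨ a = 2 ∨ 3 ≤ a := by lia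
  · rw [if_pos h1] at hset
    refine Or.inr (Or.inl ⟨h1, zsigmondyBound_of_isGreatest (n := 18) ?_, hset⟩)
    rw [hset]
    exact ⟨by simp, by simp [upperBounds]⟩
  · rw [if_neg (by lia), if_pos h2] at hset
    refine Or.inl ⟨h2, zsigmondyBound_of_isGreatest (n := 3) ?_, hset⟩
    rw [hset]
    exact isGreatest_singleton
  · rw [if_neg (by lia), if_neg (by lia)] at hset
    exact Or.inr (Or.inr ⟨by lia, by lia, zsigmondyBound_of_failureSet_eq_empty hset, hset⟩)

theorem finrank_QSqrt_le_two (d : ℕ) : Module.finrank ℚ (QSqrt d) ≤ 2 := by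
  have h0 : aeval √(d : ℝ) (X ^ 2 - C (d : ℚ)) = 0 := by
    simp [Real.sq_sqrt (Nat.cast_nonneg d)]
  have hm : (X ^ 2 - C (d : ℚ)).Monic := monic_X_pow_sub_C _ two_ne_zero
  rw [IntermediateField.adjoin.finrank ⟨_, hm, by simp⟩]
  exact (natDegree_le_of_dvd (minpoly.dvd ℚ _ h0) hm.ne_zero).trans_eq natDegree_X_pow_sub_C

theorem finrank_ringOfIntegers_QSqrt {d : ℕ} {u : 𝓞 (QSqrt d)}
    (hu : algebraMap ℤ (𝓞 (QSqrt d)) (Algebra.norm ℤ u) ≠ u) :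
    Module.finrank ℤ (𝓞 (QSqrt d)) = 2 := by
  have hle : Module.finrank ℤ (𝓞 (QSqrt d)) ≤ 2 :=
    (NumberField.RingOfIntegers.rank (QSqrt d)).trans_le (finrank_QSqrt_le_two d)
  have hne : Module.finrank ℤ (𝓞 (QSqrt d)) ≠ 1 := fun h =>
    hu (algebraMap_norm_eq_self (Module.finBasisOfFinrankEq ℤ _ h) u)
  have hpos : 0 < Module.finrank ℤ (𝓞 (QSqrt d)) := Module.finrank_pos
  lia

theorem theorem3p2 (d : ℕ) (hd_pos : 0 < d) (hd : Squarefree d)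
    (u : (𝓞 (QSqrt d))ˣ)
    (hu_norm : Algebra.norm ℤ (u : 𝓞 (QSqrt d)) = -1)
    (x : ℝ) (hx : x = (((u : 𝓞 (QSqrt d)) : QSqrt d) : ℝ)) (hx_one : 1 < x)
    (Δ' : ℕ → ℤ) (hΔ' : Δ' = removeTwoModFour (lehmerPierce (u : 𝓞 (QSqrt d)))) :
    (13 < x → zsigmondyBound Δ' ≤ 4) ∧
    (x ≤ 13 →
      (x = 1 + √2 ∧ zsigmondyBound Δ' = 3 ∧ failureSet Δ' = {3}) ∨
      (x = (1 + √5) / 2 ∧ zsigmondyBound Δ' = 18 ∧ failureSet Δ' = {1, 9, 15, 18}) ∨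
      (x ≠ 1 + √2 ∧ x ≠ (1 + √5) / 2 ∧ zsigmondyBound Δ' = 1 ∧ failureSet Δ' = ∅)) := by
  subst hx hΔ'
  have hu : algebraMap ℤ (𝓞 (QSqrt d)) (Algebra.norm ℤ (u : 𝓞 (QSqrt d))) ≠ u := by
    intro h
    rw [← h, hu_norm] at hx_one
    norm_num at hx_one
  have h := theorem3p2_general (finrank_ringOfIntegers_QSqrt hu)
    ((algebraMap (QSqrt d) ℝ).comp (algebraMap (𝓞 (QSqrt d)) (QSqrt d))) u hu_norm hx_one _ rfl
  refine ⟨fun hx => ?_, fun _ => h⟩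
  rcases h with ⟨-, h, -⟩ | ⟨hu, -, -⟩ | ⟨-, -, h, -⟩
  · exact h.trans_le (by norm_num)
  · exact absurd (hx.trans_eq hu) (Real.goldenRatio_lt_two.trans (by norm_num)).not_gt
  · exact h.trans_le (by norm_num)
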